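/- For integers $n,d\ge 1$ let $$T_d(n)=\{(x_1,\dots,x_d)\in\mathbb Z_{\ge 0}^d : x_1+\dots+x_d\le n-1\}\subset\mathbb R^d .$$ Let $f(n,d)$ be the smallest number of affine hyperplanes of $\mathbb R^d$ (affine subspaces of dimension $d-1$) whose union contains $T_d(n)$. For $k\ge 1$ let $f(n,d,k)$ be the smallest cardinality (counted with multiplicity) of a multiset of affine hyperplanes of $\mathbb R^d$ such that every point of $T_d(n)$ lies on at least $k$ members of the multiset, counted with multiplicity. Then, for every $n\ge 1$: (a) for every $d\ge 1$, $f(n,d)=n$; (b) for every $d\ge 1$, $f(n,d,2)=n+\lceil n/d\rceil$; (c) for every $d\ge 3$, $f(n,d,3)=\left(1+\frac{2}{d-1}\right)n+O_d(1)$; that is, for every $d\ge 3$ there is a constant $K_d$, depending only on $d$, such that $\left|f(n,d,3)-\left(1+\frac{2}{d-1}\right)n\right|\le K_d$ for all $n\ge 1$. -/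

import Mathlib

/-- The triangular grid `T_d(n)`: the points of `ℝ^d` whose coordinates are nonnegative integers
with sum at most `n - 1`. The last condition is written `sum < n` to avoid subtraction in `ℕ`. -/
def triGrid (d n : ℕ) : Set (Fin d → ℝ) :=
  {x | ∃ a : Fin d → ℕ, (∀ i, x i = (a i : ℝ)) ∧ ∑ i, a i < n}

/-- Affine hyperplanes of `ℝ^d`: nonempty affine subspaces of dimension `d - 1`. -/
def IsHyperplane {d : ℕ} (H : AffineSubspace ℝ (Fin d → ℝ)) : Prop :=
  (H : Set (Fin d → ℝ)).Nonempty ∧ Module.finrank ℝ H.direction + 1 = d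

/-- A finite set `C` of affine hyperplanes covers `T_d(n)` if every point of the grid lies on
a member of `C`. -/
def IsCover (n d : ℕ) (C : Finset (AffineSubspace ℝ (Fin d → ℝ))) : Prop :=
  (∀ H ∈ C, IsHyperplane H) ∧ ∀ p ∈ triGrid d n, ∃ H ∈ C, p ∈ H

open Classical in
/-- A finite multiset `C` of affine hyperplanes is a `k`-cover of `T_d(n)` if every point of the
grid lies on at least `k` members of `C`, counted with multiplicity. -/
def IsKCover (n d k : ℕ) (C : Multiset (AffineSubspace ℝ (Fin d → ℝ))) : Prop :=
  (∀ H ∈ C, IsHyperplane H) ∧ ∀ p ∈ triGrid d n, k ≤ C.countP (fun H => p ∈ H)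

/-- `f(n,d)`: the least number of affine hyperplanes that cover `T_d(n)`. -/
noncomputable def coverNumber (n d : ℕ) : ℕ :=
  sInf {m : ℕ | ∃ C : Finset (AffineSubspace ℝ (Fin d → ℝ)), IsCover n d C ∧ C.card = m}

/-- `f(n,d,k)`: the least cardinality, counted with multiplicity, of a `k`-cover of `T_d(n)`. -/
noncomputable def kCoverNumber (n d k : ℕ) : ℕ :=
  sInf {m : ℕ | ∃ C : Multiset (AffineSubspace ℝ (Fin d → ℝ)), IsKCover n d k C ∧ C.card = m}

/-! In barycentric coordinates the grid is the set of points of `ℕ^(d+1)` with sum `n - 1`, all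
coordinates play the same role, and hyperplanes become nonconstant forms.

Upper bounds use layers parallel to the facets, `w p` of them at facet `p`: a point missed at every
facet in `B` has coordinate sum at least `∑ p ∈ B, w p`, which is impossible once this is at least
`n`.

Lower bounds go by induction on the dimension through `exists_section`. Let `a` be the least depth,
over all facets, of a layer that no form cuts out. Then at least `(d + 1) * a` forms are parallel to
facets, and the uncut layer is a smaller simplex covered without at least `a` of the forms. For `k =
2, 3` these two estimates balance at the ratios `1 + 1/d` and `1 + 2/(d-1)`. The induction starts in
dimension one for `k = 1, 2` and in dimension three for `k = 3`. That last base case,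
`two_mul_le_card_of_four`, slices the tetrahedron into rectangles `x₀ + x₁ = t` and averages over
the three pairings of the coordinates. -/

/-- A family of affine forms `∑ j, lam i j * a j = c i`, indexed by `s`, whose zero sets cover every
lattice point `a ≥ 0` with `∑ j, a j = m` at least `k` times. -/
structure FormCover {ι : Type*} {D : ℕ} (k m : ℕ) (s : Finset ι) (lam : ι → Fin D → ℝ)
    (c : ι → ℝ) : Prop where
  nonconst : ∀ i ∈ s, ∃ p q, lam i p ≠ lam i q
  cover : ∀ a : Fin D → ℕ, ∑ j, a j = m →
    k ≤ (s.filter fun i => ∑ j, lam i j * (a j : ℝ) = c i).card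

namespace FormCover

variable {ι : Type*}

/-- Reindexing the barycentric coordinates. -/
theorem comp_perm {D k m : ℕ} {s : Finset ι} {lam : ι → Fin D → ℝ} {c : ι → ℝ}
    (h : FormCover k m s lam c) (e : Equiv.Perm (Fin D)) :
    FormCover k m s (fun i j => lam i (e j)) c := by
  refine ⟨fun i hi => ?_, fun a ha => ?_⟩
  · obtain ⟨p, q, hpq⟩ := h.nonconst i hi
    exact ⟨e.symm p, e.symm q, by simpa using hpq⟩
  · have h1 := h.cover (fun j => a (e.symm j)) (by rw [Equiv.sum_comp e.symm a, ha])
    refine h1.trans (le_of_eq ?_)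
    congr 1
    refine Finset.filter_congr fun i _ => ?_
    rw [← Equiv.sum_comp e (fun j => lam i j * ((a (e.symm j) : ℕ) : ℝ))]
    simp

/-- In dimension one, every form vanishes at no more than one point. -/
theorem mul_le_card_of_two {k m : ℕ} {s : Finset ι} {lam : ι → Fin 2 → ℝ} {c : ι → ℝ}
    (h : FormCover k m s lam c) : k * (m + 1) ≤ s.card := by
  have key := Finset.card_mul_le_card_mul (s := Finset.range (m + 1)) (t := s) (m := k) (n := 1)
    (fun (u : ℕ) i => lam i 0 * (u : ℝ) + lam i 1 * ((m : ℝ) - u) = c i) ?_ ?_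
  · simpa [mul_comm] using key
  · intro u hu
    have hu' : u ≤ m := Nat.lt_succ_iff.mp (Finset.mem_range.mp hu)
    have := h.cover ![u, m - u] (by simp; omega)
    simpa [Finset.bipartiteAbove, Fin.sum_univ_two, Nat.cast_sub hu'] using this
  · intro i hi
    rw [Finset.card_le_one]
    intro u hu v hv
    simp only [Finset.bipartiteBelow, Finset.mem_filter] at hu hv
    have hne : lam i 0 ≠ lam i 1 := by
      obtain ⟨p, q, hpq⟩ := h.nonconst i hi
      intro h01
      fin_cases p <;> fin_cases q <;> simp_all
    have : (lam i 0 - lam i 1) * ((u : ℝ) - v) = 0 := by linarith [hu.2, hv.2]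
    rcases mul_eq_zero.mp this with h0 | h0
    · exact absurd (sub_eq_zero.mp h0) hne
    · exact_mod_cast sub_eq_zero.mp h0

/-! ### Layers parallel to the facets and the dimension recursion -/

/-- The form `i` cuts out the layer of points whose `p`-th coordinate is `l`. -/
def IsLayer {D : ℕ} (m : ℕ) (lam : ι → Fin D → ℝ) (c : ι → ℝ) (p : Fin D) (l : ℕ) (i : ι) : Prop :=
  ∃ b, (∀ j, j ≠ p → lam i j = b) ∧ lam i p * (l : ℝ) + b * ((m : ℝ) - l) = c i

/-- The form `i` is parallel to the facet opposite to the vertex `p`. -/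
def IsParallel {D : ℕ} (lam : ι → Fin D → ℝ) (p : Fin D) (i : ι) : Prop :=
  ∃ b, ∀ j, j ≠ p → lam i j = b

theorem IsLayer.unique {D m : ℕ} {lam : ι → Fin (D + 2) → ℝ} {c : ι → ℝ} {p : Fin (D + 2)}
    {l l' : ℕ} {i : ι} (hi : ∃ p q, lam i p ≠ lam i q) (h : IsLayer m lam c p l i)
    (h' : IsLayer m lam c p l' i) : l = l' := by
  obtain ⟨b, hb, e⟩ := h
  obtain ⟨b', hb', e'⟩ := h'
  obtain ⟨q, hq⟩ := exists_ne p
  have hbb : b = b' := by rw [← hb q hq, hb' q hq]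
  subst hbb
  have hne : lam i p ≠ b := by
    intro hp
    obtain ⟨x, y, hxy⟩ := hi
    have all : ∀ j, lam i j = b := fun j => by
      by_cases hj : j = p
      · rw [hj, hp]
      · exact hb j hj
    exact hxy (by rw [all x, all y])
  have : (lam i p - b) * ((l : ℝ) - l') = 0 := by linarith
  rcases mul_eq_zero.mp this with h0 | h0
  · exact absurd (sub_eq_zero.mp h0) hne
  · exact_mod_cast sub_eq_zero.mp h0

/-- A coordinate other than `p` and `q` forces the two constants to agree, so the form would be
constant. Hence the families parallel to different facets are disjoint and their sizes add up. -/
theorem IsParallel.eq_of_nonconst {D : ℕ} {lam : ι → Fin (D + 3) → ℝ} {p q : Fin (D + 3)} {i : ι}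
    (hi : ∃ p q, lam i p ≠ lam i q) (hp : IsParallel lam p i) (hq : IsParallel lam q i) :
    p = q := by
  by_contra hpq
  obtain ⟨b, hb⟩ := hp
  obtain ⟨b', hb'⟩ := hq
  obtain ⟨r, hr⟩ : ∃ r, r ∉ ({p, q} : Finset (Fin (D + 3))) := by
    by_contra! hall
    have h1 := Finset.card_le_card (fun x _ => hall x : (Finset.univ : Finset (Fin (D + 3))) ⊆ _)
    have h2 := Finset.card_le_two (a := p) (b := q)
    simp only [Finset.card_univ, Fintype.card_fin] at h1
    omega
  simp only [Finset.mem_insert, Finset.mem_singleton, not_or] at hr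
  have hbb : b = b' := by rw [← hb r hr.1, hb' r hr.2]
  obtain ⟨x, y, hxy⟩ := hi
  have all : ∀ j, lam i j = b := fun j => by
    by_cases hj : j = p
    · rw [hbb]; exact hb' j (by rw [hj]; exact hpq)
    · exact hb j hj
  exact hxy (by rw [all x, all y])

/-- Lower bound recursion: either many forms are parallel to the facets, or a layer that is cut out
by no form inherits a cover in one dimension less. -/
theorem exists_section {d k m : ℕ} {s : Finset ι} {lam : ι → Fin (d + 3) → ℝ} {c : ι → ℝ}
    (h : FormCover k m s lam c) :
    ∃ a ≤ m + 1, (d + 3) * a ≤ s.card ∧ (a ≤ m →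
      ∃ (s' : Finset ι) (lam' : ι → Fin (d + 2) → ℝ) (c' : ι → ℝ),
        FormCover k (m - a) s' lam' c' ∧ a + s'.card ≤ s.card) := by
  classical
  -- The alternative `l = m + 1` makes the first uncut layer `a p` defined even when all layers are
  -- cut out.
  have hex : ∀ p : Fin (d + 3), ∃ l, l = m + 1 ∨ ∀ i ∈ s, ¬ IsLayer m lam c p l i :=
    fun p => ⟨m + 1, Or.inl rfl⟩
  let a : Fin (d + 3) → ℕ := fun p => Nat.find (hex p)
  have ha_le : ∀ p, a p ≤ m + 1 := fun p => Nat.find_min' (hex p) (Or.inl rfl)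
  have ha_lt : ∀ p, ∀ l < a p, ∃ i ∈ s, IsLayer m lam c p l i := by
    intro p l hl
    have := Nat.find_min (hex p) hl
    push Not at this
    exact this.2
  let par : Fin (d + 3) → Finset ι := fun p => s.filter (IsParallel lam p)
  have hcard : ∀ p, a p ≤ (par p).card := by
    intro p
    have := Finset.card_le_card_of_forall_subsingleton (s := Finset.range (a p)) (t := par p)
      (fun l i => IsLayer m lam c p l i) ?_ ?_
    · simpa using this
    · intro l hl
      obtain ⟨i, hi, hl'⟩ := ha_lt p l (Finset.mem_range.mp hl)
      exact ⟨i, Finset.mem_filter.mpr ⟨hi, hl'.imp fun b hb => hb.1⟩, hl'⟩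
    · intro i hi l hl l' hl'
      exact IsLayer.unique (h.nonconst i (Finset.mem_filter.mp hi).1) hl.2 hl'.2
  have hsum : ∑ p, a p ≤ s.card := by
    calc ∑ p, a p ≤ ∑ p, (par p).card := Finset.sum_le_sum fun p _ => hcard p
      _ = (Finset.univ.biUnion par).card := by
        rw [Finset.card_biUnion]
        intro p _ q _ hpq
        refine Finset.disjoint_left.mpr fun i hi hi' => ?_
        simp only [par, Finset.mem_filter] at hi hi'
        exact hpq (IsParallel.eq_of_nonconst (h.nonconst i hi.1) hi.2 hi'.2)
      _ ≤ s.card := Finset.card_le_card (Finset.biUnion_subset.mpr fun p _ =>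
          Finset.filter_subset _ _)
  obtain ⟨p, -, hp⟩ := Finset.exists_min_image Finset.univ a Finset.univ_nonempty
  refine ⟨a p, ha_le p, ?_, fun ham => ?_⟩
  · refine le_trans ?_ hsum
    calc (d + 3) * a p = ∑ _q : Fin (d + 3), a p := by simp
      _ ≤ _ := Finset.sum_le_sum fun q hq => hp q hq
  · refine ⟨s.filter fun i => ¬ IsParallel lam p i, fun i j => lam i (p.succAbove j),
      fun i => c i - lam i p * (a p : ℝ), ⟨fun i hi => ?_, fun x hx => ?_⟩, ?_⟩
    · by_contra! hcon
      refine (Finset.mem_filter.mp hi).2 ⟨lam i (p.succAbove 0), fun j hj => ?_⟩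
      obtain ⟨r, rfl⟩ := Fin.exists_succAbove_eq hj
      exact hcon r 0
    · have hlayer : ∀ i ∈ s, ¬ IsLayer m lam c p (a p) i := by
        rcases Nat.find_spec (hex p) with h0 | h0
        · exact absurd h0 (by change a p ≠ m + 1; omega)
        · exact h0
      refine (h.cover (Fin.insertNth p (a p) x) ?_).trans (Finset.card_le_card ?_)
      · rw [Fin.sum_univ_succAbove _ p]
        simp [hx]; omega
      · intro i hi
        simp only [Finset.mem_filter] at hi ⊢
        obtain ⟨his, hi⟩ := hi
        rw [Fin.sum_univ_succAbove _ p] at hi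
        simp only [Fin.insertNth_apply_same, Fin.insertNth_apply_succAbove] at hi
        -- A parallel form vanishing at one point of the layer would cut out the whole layer.
        refine ⟨⟨his, fun ⟨b, hb⟩ => hlayer i his ⟨b, hb, ?_⟩⟩, by linarith⟩
        rw [← hi]
        congr 1
        rw [Finset.sum_congr rfl fun j _ => by rw [hb _ (Fin.succAbove_ne p j)], ← Finset.mul_sum]
        rw [← Nat.cast_sum, hx, Nat.cast_sub ham]
    · have := Finset.card_filter_add_card_filter_not (s := s) (IsParallel lam p)
      have h2 := hcard p
      simp only [par] at h2
      omega

/-! ### Triple covers in dimension three -/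

/-- Counting on one row of the rectangle `x₀ + x₁ = t`, when no form cuts out this rectangle. -/
theorem two_mul_le_card_of_row {m : ℕ} {s : Finset ι} {lam : ι → Fin 4 → ℝ} {c : ι → ℝ}
    (h : FormCover 3 m s lam c) {t : ℕ} (ht : t ≤ m)
    (habs : ∀ i ∈ s, lam i 0 = lam i 1 → lam i 2 = lam i 3 →
      lam i 0 * (t : ℝ) + lam i 2 * ((m : ℝ) - t) ≠ c i)
    (hH : (s.filter fun i => lam i 0 ≠ lam i 1 ∧ lam i 2 = lam i 3).card < 2 * (t + 1)) :
    2 * (m - t + 1) ≤ (s.filter fun i => lam i 2 ≠ lam i 3).card := by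
  classical
  set H := s.filter fun i => lam i 0 ≠ lam i 1 ∧ lam i 2 = lam i 3 with hHdef
  let r : ℕ → ι → Prop := fun u i =>
    lam i 0 * (u : ℝ) + lam i 1 * ((t : ℝ) - u) + lam i 2 * ((m : ℝ) - t) = c i
  -- Each form of `H` meets at most one row `x₀ = u`, so some row meets at most one of them. Its
  -- points each still need two forms with `lam i 2 ≠ lam i 3`, and such a form meets the row at
  -- most once.
  obtain ⟨u, hu, hu1⟩ : ∃ u ∈ Finset.range (t + 1), (H.filter (r u)).card < 2 := by
    by_contra! hcon
    have key := Finset.card_mul_le_card_mul (s := Finset.range (t + 1)) (t := H) (m := 2) (n := 1)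
      r hcon ?_
    · rw [Finset.card_range] at key
      omega
    · intro i hi
      rw [Finset.card_le_one]
      intro u hu v hv
      simp only [Finset.bipartiteBelow, Finset.mem_filter, r] at hu hv
      have hne : lam i 0 ≠ lam i 1 := (Finset.mem_filter.mp hi).2.1
      have : (lam i 0 - lam i 1) * ((u : ℝ) - v) = 0 := by linarith [hu.2, hv.2]
      rcases mul_eq_zero.mp this with h0 | h0
      · exact absurd (sub_eq_zero.mp h0) hne
      · exact_mod_cast sub_eq_zero.mp h0
  have hut : u ≤ t := Nat.lt_succ_iff.mp (Finset.mem_range.mp hu)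
  have key := Finset.card_mul_le_card_mul (s := Finset.range (m - t + 1))
    (t := s.filter fun i => lam i 2 ≠ lam i 3) (m := 2) (n := 1)
    (fun (v : ℕ) i => lam i 0 * (u : ℝ) + lam i 1 * ((t : ℝ) - u) + lam i 2 * (v : ℝ)
      + lam i 3 * ((m : ℝ) - t - v) = c i) ?_ ?_
  · rw [Finset.card_range] at key
    omega
  · intro v hv
    have hvm : v ≤ m - t := Nat.lt_succ_iff.mp (Finset.mem_range.mp hv)
    have hcov := h.cover ![u, t - u, v, m - t - v] (by simp [Fin.sum_univ_four]; omega)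
    have hsub : (s.filter fun i => ∑ j, lam i j * ((![u, t - u, v, m - t - v] j : ℕ) : ℝ) = c i) ⊆
        H.filter (r u) ∪ Finset.bipartiteAbove (fun (v : ℕ) i => lam i 0 * (u : ℝ)
          + lam i 1 * ((t : ℝ) - u) + lam i 2 * (v : ℝ)
          + lam i 3 * ((m : ℝ) - t - v) = c i) (s.filter fun i => lam i 2 ≠ lam i 3) v := by
      intro i hi
      simp only [Finset.mem_filter, Fin.sum_univ_four] at hi
      obtain ⟨his, hi⟩ := hi
      simp [Nat.cast_sub hut, Nat.cast_sub hvm, Nat.cast_sub ht] at hi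
      simp only [Finset.mem_union, Finset.mem_filter, Finset.bipartiteAbove, hHdef, r]
      by_cases h23 : lam i 2 = lam i 3
      · left
        refine ⟨⟨his, fun h01 => habs i his h01 h23 ?_, h23⟩, ?_⟩
        · rw [← hi, ← h01, ← h23]; ring
        · rw [← hi, ← h23]; ring
      · exact Or.inr ⟨⟨his, h23⟩, hi⟩
    have h1 := (Finset.card_le_card hsub).trans (Finset.card_union_le _ _)
    omega
  · intro i hi
    rw [Finset.card_le_one]
    intro u hu v hv
    simp only [Finset.bipartiteBelow, Finset.mem_filter] at hu hv
    have hne : lam i 2 ≠ lam i 3 := (Finset.mem_filter.mp hi).2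
    have : (lam i 2 - lam i 3) * ((u : ℝ) - v) = 0 := by linarith [hu.2, hv.2]
    rcases mul_eq_zero.mp this with h0 | h0
    · exact absurd (sub_eq_zero.mp h0) hne
    · exact_mod_cast sub_eq_zero.mp h0

/-- For the pairing `01|23` of the four barycentric coordinates, either the cover is large or many
forms are constant on one of the two pairs. -/
theorem le_card_or_of_pairing {m : ℕ} {s : Finset ι} {lam : ι → Fin 4 → ℝ} {c : ι → ℝ}
    (h : FormCover 3 m s lam c) :
    2 * (m + 1) ≤ s.card ∨ 2 * (m + 1) ≤
      (s.filter fun i => lam i 0 = lam i 1).card + (s.filter fun i => lam i 2 = lam i 3).card := by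
  classical
  set S := s.filter fun i => lam i 0 = lam i 1 ∧ lam i 2 = lam i 3 with hS
  set H := s.filter fun i => lam i 0 ≠ lam i 1 ∧ lam i 2 = lam i 3 with hH
  set V := s.filter fun i => lam i 2 ≠ lam i 3 ∧ lam i 0 = lam i 1 with hV
  have e23 : (s.filter fun i => lam i 2 = lam i 3).card = S.card + H.card := by
    rw [← Finset.card_filter_add_card_filter_not (s := s.filter fun i => lam i 2 = lam i 3)
      (fun i => lam i 0 = lam i 1), Finset.filter_filter, Finset.filter_filter]
    simp only [hS, hH, and_comm, ne_eq]
  have e01 : (s.filter fun i => lam i 0 = lam i 1).card = S.card + V.card := by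
    rw [← Finset.card_filter_add_card_filter_not (s := s.filter fun i => lam i 0 = lam i 1)
      (fun i => lam i 2 = lam i 3), Finset.filter_filter, Finset.filter_filter]
    simp only [hS, hV, and_comm, ne_eq]
  have n23 := Finset.card_filter_add_card_filter_not (s := s) (fun i => lam i 2 = lam i 3)
  have n01 := Finset.card_filter_add_card_filter_not (s := s) (fun i => lam i 0 = lam i 1)
  let Q : ℕ → ι → Prop := fun t i => lam i 0 * (t : ℝ) + lam i 2 * ((m : ℝ) - t) = c i
  have present : ∀ A : Finset ℕ, (∀ t ∈ A, ∃ i ∈ S, Q t i) → A.card ≤ S.card := by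
    intro A hA
    refine Finset.card_le_card_of_forall_subsingleton Q hA fun i hi t ht t' ht' => ?_
    obtain ⟨his, h01, h23⟩ := Finset.mem_filter.mp hi
    have hne : lam i 0 ≠ lam i 2 := by
      intro h02
      obtain ⟨p, q, hpq⟩ := h.nonconst i his
      have all : ∀ j, lam i j = lam i 0 := by
        intro j
        fin_cases j
        · rfl
        · exact h01.symm
        · exact h02.symm
        · exact (h02.trans h23).symm
      exact hpq (by rw [all p, all q])
    have e1 : lam i 0 * (t : ℝ) + lam i 2 * ((m : ℝ) - t) = c i := ht.2
    have e2 : lam i 0 * (t' : ℝ) + lam i 2 * ((m : ℝ) - t') = c i := ht'.2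
    have : (lam i 0 - lam i 2) * ((t : ℝ) - t') = 0 := by linarith
    rcases mul_eq_zero.mp this with h0 | h0
    · exact absurd (sub_eq_zero.mp h0) hne
    · exact_mod_cast sub_eq_zero.mp h0
  -- For `t` in `I` both `H.card < 2 * (t + 1)` and `V.card < 2 * (m - t + 1)`, so the row count and
  -- its mirror image apply to every rectangle in `M`, that is, cut out by no form of `S`.
  let I : Finset ℕ := Finset.Ico (H.card / 2) (m + 1 - V.card / 2)
  let M : Finset ℕ := I.filter fun t => ¬ ∃ i ∈ S, Q t i
  by_cases hM : M.Nonempty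
  · left
    have hmin := M.min'_mem hM
    have hmax := M.max'_mem hM
    have hlow : ∀ t ∈ Finset.Ico (H.card / 2) (M.min' hM), ∃ i ∈ S, Q t i := by
      intro t ht
      by_contra hcon
      have hb := (Finset.mem_filter.mp hmin).1
      simp only [I, Finset.mem_Ico] at hb ht
      have := M.min'_le t (Finset.mem_filter.mpr ⟨Finset.mem_Ico.mpr ⟨ht.1, by omega⟩, hcon⟩)
      omega
    have hhigh : ∀ t ∈ Finset.Ico (M.max' hM + 1) (m + 1 - V.card / 2), ∃ i ∈ S, Q t i := by
      intro t ht
      by_contra hcon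
      have hb := (Finset.mem_filter.mp hmax).1
      simp only [I, Finset.mem_Ico] at hb ht
      have := M.le_max' t (Finset.mem_filter.mpr ⟨Finset.mem_Ico.mpr ⟨by omega, ht.2⟩, hcon⟩)
      omega
    have hle := M.min'_le _ hmax
    set t₁ := M.min' hM
    set t₂ := M.max' hM
    have hcardS := present (Finset.Ico (H.card / 2) t₁ ∪
        Finset.Ico (t₂ + 1) (m + 1 - V.card / 2)) (fun t ht =>
      (Finset.mem_union.mp ht).elim (hlow t) (hhigh t))
    rw [Finset.card_union_of_disjoint, Nat.card_Ico, Nat.card_Ico] at hcardS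
    swap
    · rw [Finset.disjoint_left]
      intro t ht ht'
      rw [Finset.mem_Ico] at ht ht'
      omega
    obtain ⟨hI1, hA1⟩ := Finset.mem_filter.mp hmin
    obtain ⟨hI2, hA2⟩ := Finset.mem_filter.mp hmax
    simp only [I, Finset.mem_Ico] at hI1 hI2
    -- Rows are counted at the first missing rectangle and columns at the last; the forms of `S`
    -- cutting out the rectangles outside `[t₁, t₂]` make up the difference.
    have r1 := h.two_mul_le_card_of_row (t := t₁) (by omega)
      (fun i hi h01 h23 he => hA1 ⟨i, Finset.mem_filter.mpr ⟨hi, h01, h23⟩, he⟩)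
      (by change H.card < _; omega)
    let e : Equiv.Perm (Fin 4) := Equiv.swap 0 2 * Equiv.swap 1 3
    have he0 : e 0 = 2 := by decide
    have he1 : e 1 = 3 := by decide
    have he2 : e 2 = 0 := by decide
    have he3 : e 3 = 1 := by decide
    have r2 := (h.comp_perm e).two_mul_le_card_of_row (t := m - t₂) (by omega)
      (by
        simp only [he0, he1, he2, he3]
        intro i hi h23 h01 heq
        refine hA2 ⟨i, Finset.mem_filter.mpr ⟨hi, h01, h23⟩, ?_⟩
        rw [Nat.cast_sub (by omega)] at heq
        change lam i 0 * (t₂ : ℝ) + lam i 2 * ((m : ℝ) - t₂) = c i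
        linarith)
      (by
        simp only [he0, he1, he2, he3]
        change V.card < _
        omega)
    simp only [he2, he3] at r2
    simp only [← ne_eq] at n01 n23
    omega
  · right
    rw [Finset.not_nonempty_iff_eq_empty] at hM
    have := present I (fun t ht => by
      by_contra hcon
      exact Finset.notMem_empty t (hM ▸ Finset.mem_filter.mpr ⟨ht, hcon⟩))
    simp only [I, Nat.card_Ico] at this
    omega

/-- A nonconstant vector of length four has no more than three pairs of equal entries. -/
theorem card_equal_pairs_le (f : Fin 4 → ℝ) (hf : ∃ p q, f p ≠ f q) :
    (if f 0 = f 1 then 1 else 0) + (if f 2 = f 3 then 1 else 0) + (if f 0 = f 2 then 1 else 0) +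
      (if f 1 = f 3 then 1 else 0) + (if f 0 = f 3 then 1 else 0) + (if f 1 = f 2 then 1 else 0)
      ≤ 3 := by
  have hne : ¬ (f 0 = f 1 ∧ f 0 = f 2 ∧ f 0 = f 3) := by
    rintro ⟨h1, h2, h3⟩
    obtain ⟨p, q, hpq⟩ := hf
    have all : ∀ j, f j = f 0 := by
      intro j
      fin_cases j
      · rfl
      · exact h1.symm
      · exact h2.symm
      · exact h3.symm
    exact hpq (by rw [all p, all q])
  clear hf
  generalize f 0 = a at *
  generalize f 1 = b at *
  generalize f 2 = c at *
  generalize f 3 = d at *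
  grind

/-- If every pairing gives the second alternative, there are at least `6 * (m + 1)` incidences of
forms with equal coordinate pairs, while each form has at most three. -/
theorem two_mul_le_card_of_four {m : ℕ} {s : Finset ι} {lam : ι → Fin 4 → ℝ} {c : ι → ℝ}
    (h : FormCover 3 m s lam c) : 2 * (m + 1) ≤ s.card := by
  classical
  have hA := h.le_card_or_of_pairing
  have hB := (h.comp_perm (Equiv.swap 1 2)).le_card_or_of_pairing
  have hC := (h.comp_perm (Equiv.swap 1 3)).le_card_or_of_pairing
  have e1 : (Equiv.swap 1 2 : Equiv.Perm (Fin 4)) 0 = 0 := by decide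
  have e2 : (Equiv.swap 1 2 : Equiv.Perm (Fin 4)) 3 = 3 := by decide
  have e3 : (Equiv.swap 1 3 : Equiv.Perm (Fin 4)) 0 = 0 := by decide
  have e4 : (Equiv.swap 1 3 : Equiv.Perm (Fin 4)) 2 = 2 := by decide
  simp only [e1, e2, Equiv.swap_apply_left, Equiv.swap_apply_right] at hB
  simp only [e3, e4, Equiv.swap_apply_left, Equiv.swap_apply_right] at hC
  have h21 : (s.filter fun i => lam i 2 = lam i 1) = s.filter fun i => lam i 1 = lam i 2 :=
    Finset.filter_congr fun i _ => eq_comm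
  rw [h21] at hC
  have hsum : ∑ i ∈ s, ((if lam i 0 = lam i 1 then 1 else 0) + (if lam i 2 = lam i 3 then 1 else 0)
      + (if lam i 0 = lam i 2 then 1 else 0) + (if lam i 1 = lam i 3 then 1 else 0)
      + (if lam i 0 = lam i 3 then 1 else 0) + (if lam i 1 = lam i 2 then 1 else 0)) ≤ s.card * 3 :=
    Finset.sum_le_card_nsmul s _ 3 fun i hi => card_equal_pairs_le (lam i) (h.nonconst i hi)
  simp only [Finset.sum_add_distrib, ← Finset.card_filter] at hsum
  omega

/-! ### Lower bounds by induction on the dimension -/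

theorem le_card {d k m : ℕ} (hk : 1 ≤ k) {s : Finset ι} {lam : ι → Fin (d + 2) → ℝ} {c : ι → ℝ}
    (h : FormCover k m s lam c) : m + 1 ≤ s.card := by
  induction d generalizing m s c with
  | zero => nlinarith [h.mul_le_card_of_two]
  | succ d ih =>
    obtain ⟨a, ha, h1, h2⟩ := h.exists_section
    by_cases ham : a ≤ m
    · obtain ⟨s', lam', c', h', hc⟩ := h2 ham
      have := ih h'
      omega
    · nlinarith

theorem mul_le_mul_card_of_two {d m : ℕ} {s : Finset ι} {lam : ι → Fin (d + 2) → ℝ} {c : ι → ℝ}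
    (h : FormCover 2 m s lam c) : (d + 2) * (m + 1) ≤ (d + 1) * s.card := by
  induction d generalizing m s c with
  | zero => linarith [h.mul_le_card_of_two]
  | succ d ih =>
    obtain ⟨a, ha, h1, h2⟩ := h.exists_section
    -- At this threshold the facet count and the section bound agree.
    by_cases hd : m + 1 ≤ (d + 2) * a
    · calc (d + 1 + 2) * (m + 1) ≤ (d + 1 + 2) * ((d + 2) * a) := Nat.mul_le_mul_left _ hd
        _ = (d + 1 + 1) * ((d + 3) * a) := by ring
        _ ≤ _ := Nat.mul_le_mul_left _ h1
    · have ham : a ≤ m := by nlinarith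
      obtain ⟨s', lam', c', h', hc⟩ := h2 ham
      have h3 := ih h'
      obtain ⟨b, rfl⟩ := Nat.exists_eq_add_of_le ham
      rw [Nat.add_sub_cancel_left] at h3
      have h4 : (d + 1) * (a + s'.card) ≤ (d + 1) * s.card := Nat.mul_le_mul_left _ hc
      refine Nat.le_of_mul_le_mul_left ?_ (Nat.succ_pos d)
      nlinarith

theorem mul_le_mul_card_of_three {d m : ℕ} {s : Finset ι} {lam : ι → Fin (d + 4) → ℝ} {c : ι → ℝ}
    (h : FormCover 3 m s lam c) : (d + 4) * (m + 1) ≤ (d + 2) * s.card := by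
  induction d generalizing m s c with
  | zero => linarith [h.two_mul_le_card_of_four]
  | succ d ih =>
    obtain ⟨a, ha, h1, h2⟩ := h.exists_section
    by_cases hd : m + 1 ≤ (d + 3) * a
    · calc (d + 1 + 4) * (m + 1) ≤ (d + 1 + 4) * ((d + 3) * a) := Nat.mul_le_mul_left _ hd
        _ = (d + 1 + 2) * ((d + 5) * a) := by ring
        _ ≤ _ := Nat.mul_le_mul_left _ h1
    · have ham : a ≤ m := by nlinarith
      obtain ⟨s', lam', c', h', hc⟩ := h2 ham
      have h3 := ih h'
      obtain ⟨b, rfl⟩ := Nat.exists_eq_add_of_le ham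
      rw [Nat.add_sub_cancel_left] at h3
      have h4 : (d + 2) * (a + s'.card) ≤ (d + 2) * s.card := Nat.mul_le_mul_left _ hc
      refine Nat.le_of_mul_le_mul_left ?_ (Nat.succ_pos (d + 1))
      nlinarith

end FormCover

/-! ### Hyperplanes, barycentric coordinates and layer covers -/

theorem exists_form_of_isHyperplane {d : ℕ} {H : AffineSubspace ℝ (Fin d → ℝ)}
    (hH : IsHyperplane H) :
    ∃ (l : Fin d → ℝ) (c : ℝ), (∃ j, l j ≠ 0) ∧ ∀ x, x ∈ H ↔ ∑ j, l j * x j = c := by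
  obtain ⟨⟨p, hp⟩, hd⟩ := hH
  have hlt : H.direction < ⊤ := by
    refine lt_top_iff_ne_top.mpr fun htop => ?_
    rw [htop, finrank_top, Module.finrank_fin_fun] at hd
    omega
  obtain ⟨f, hf, hle⟩ := Submodule.exists_le_ker_of_lt_top _ hlt
  have hker : H.direction = LinearMap.ker f := by
    refine Submodule.eq_of_le_of_finrank_eq hle ?_
    have := Module.Dual.finrank_ker_add_one_of_ne_zero (f := f) hf
    rw [Module.finrank_fin_fun] at this
    omega
  have hsum : ∀ x, f x = ∑ j, f (Pi.single j 1) * x j := fun x => by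
    rw [LinearMap.pi_apply_eq_sum_univ f x]
    refine Finset.sum_congr rfl fun j _ => ?_
    rw [smul_eq_mul, mul_comm]
    congr 2
    ext i
    simp [Pi.single_apply, eq_comm]
  refine ⟨fun j => f (Pi.single j 1), f p, ?_, fun x => ?_⟩
  · by_contra! hcon
    exact hf (LinearMap.ext fun x => by simp [hsum x, hcon])
  · rw [← hsum, ← AffineSubspace.vsub_right_mem_direction_iff_mem hp, hker, LinearMap.mem_ker,
      vsub_eq_sub, map_sub, sub_eq_zero]

theorem exists_isHyperplane_of_ne_zero {d : ℕ} {f : (Fin d → ℝ) →ₗ[ℝ] ℝ} (hf : f ≠ 0) (c : ℝ) :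
    ∃ H : AffineSubspace ℝ (Fin d → ℝ), IsHyperplane H ∧ ∀ x, x ∈ H ↔ f x = c := by
  obtain ⟨p, hp⟩ := LinearMap.surjective hf c
  refine ⟨AffineSubspace.mk' p (LinearMap.ker f), ⟨⟨p, AffineSubspace.self_mem_mk' _ _⟩, ?_⟩,
    fun x => ?_⟩
  · rw [AffineSubspace.direction_mk', Module.Dual.finrank_ker_add_one_of_ne_zero (f := f) hf,
      Module.finrank_fin_fun]
  · rw [AffineSubspace.mem_mk', LinearMap.mem_ker, vsub_eq_sub, map_sub, hp, sub_eq_zero]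

/-- Barycentric coordinates with respect to the simplex spanned by the grid. -/
def baryCoord {d : ℕ} (n : ℕ) (x : Fin d → ℝ) : Fin (d + 1) → ℝ :=
  Fin.cons ((n : ℝ) - 1 - ∑ j, x j) x

theorem exists_isHyperplane_layer {d : ℕ} (hd : 1 ≤ d) (n : ℕ) (p : Fin (d + 1)) (l : ℕ) :
    ∃ H : AffineSubspace ℝ (Fin d → ℝ), IsHyperplane H ∧ ∀ x, x ∈ H ↔ baryCoord n x p = l := by
  refine Fin.cases ?_ (fun j => ?_) p
  · have hf : (∑ j, LinearMap.proj j : (Fin d → ℝ) →ₗ[ℝ] ℝ) ≠ 0 := fun h0 => by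
      have := LinearMap.congr_fun h0 (fun _ => 1)
      simp at this
      omega
    obtain ⟨H, hH, hmem⟩ := exists_isHyperplane_of_ne_zero hf ((n : ℝ) - 1 - l)
    refine ⟨H, hH, fun x => ?_⟩
    rw [hmem]
    simp only [baryCoord, Fin.cons_zero, LinearMap.sum_apply, LinearMap.proj_apply]
    constructor <;> intro h <;> linarith
  · have hf : (LinearMap.proj j : (Fin d → ℝ) →ₗ[ℝ] ℝ) ≠ 0 := fun h0 => by
      have := LinearMap.congr_fun h0 (fun _ => 1)
      simp at this
    obtain ⟨H, hH, hmem⟩ := exists_isHyperplane_of_ne_zero hf (l : ℝ)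
    exact ⟨H, hH, fun x => by rw [hmem]; simp [baryCoord]⟩

theorem exists_nat_baryCoord {d n : ℕ} {x : Fin d → ℝ} (hx : x ∈ triGrid d n) :
    ∃ b : Fin (d + 1) → ℕ, (∀ p, baryCoord n x p = b p) ∧ ∑ p, b p < n := by
  obtain ⟨a, ha, hlt⟩ := hx
  refine ⟨Fin.cons (n - 1 - ∑ j, a j) a, fun p => ?_, ?_⟩
  · refine Fin.cases ?_ (fun j => ?_) p
    · have h1 : ((n - 1 - ∑ j, a j : ℕ) : ℝ) = (n : ℝ) - 1 - ((∑ j, a j : ℕ) : ℝ) := by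
        rw [Nat.cast_sub (by omega), Nat.cast_sub (by omega), Nat.cast_one]
      simp only [baryCoord, Fin.cons_zero, h1, Nat.cast_sum, ha]
    · simp [baryCoord, ha]
  · rw [Fin.sum_univ_succ]
    simp only [Fin.cons_zero, Fin.cons_succ]
    omega

/-- Covers by hyperplanes parallel to the facets: `w p` consecutive layers at the facet `p`. -/
theorem exists_isKCover_of_layers {d k : ℕ} (hd : 1 ≤ d) (n : ℕ) (w : Fin (d + 1) → ℕ)
    (hw : ∀ B : Finset (Fin (d + 1)), d + 1 < B.card + k → n ≤ ∑ p ∈ B, w p) :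
    ∃ C, IsKCover n d k C ∧ C.card = ∑ p, w p := by
  classical
  choose L hL hmem using exists_isHyperplane_layer hd n
  let s : Finset (Σ _ : Fin (d + 1), ℕ) := Finset.univ.sigma fun p => Finset.range (w p)
  refine ⟨s.val.map fun q => L q.1 q.2, ⟨fun H hH => ?_, fun x hx => ?_⟩, ?_⟩
  · obtain ⟨q, -, rfl⟩ := Multiset.mem_map.mp hH
    exact hL _ _
  · obtain ⟨b, hb, hlt⟩ := exists_nat_baryCoord hx
    have hgood : k ≤ (Finset.univ.filter fun p => b p < w p).card := by
      by_contra! hcon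
      have hnot := Finset.card_filter_add_card_filter_not (s := Finset.univ) (fun p => b p < w p)
      rw [Finset.card_univ, Fintype.card_fin] at hnot
      have h1 := hw (Finset.univ.filter fun p => ¬ b p < w p) (by omega)
      have h2 : ∑ p ∈ Finset.univ.filter (fun p => ¬ b p < w p), w p ≤ ∑ p, b p :=
        (Finset.sum_le_sum fun p hp => not_lt.mp (Finset.mem_filter.mp hp).2).trans
          (Finset.sum_le_sum_of_subset (Finset.filter_subset _ _))
      omega
    refine hgood.trans ?_
    rw [Multiset.countP_map]
    change _ ≤ (s.filter fun q => x ∈ L q.1 q.2).card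
    refine Finset.card_le_card_of_injOn (fun p => ⟨p, b p⟩) (fun p hp => ?_) fun p _ q _ hpq => ?_
    · simpa [s, hmem, hb] using hp
    · exact congrArg Sigma.fst hpq
  · simp [s]

open Classical in
/-- Passing from hyperplanes to affine forms in barycentric coordinates. -/
theorem IsKCover.exists_formCover {n d k : ℕ} (hn : 1 ≤ n)
    {C : Multiset (AffineSubspace ℝ (Fin d → ℝ))} (hC : IsKCover n d k C) :
    ∃ (ι : Type) (s : Finset ι) (lam : ι → Fin (d + 1) → ℝ) (c : ι → ℝ),
      FormCover k (n - 1) s lam c ∧ s.card = C.card := by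
  have hform : ∀ i : C, ∃ (l : Fin d → ℝ) (c : ℝ), (∃ j, l j ≠ 0) ∧
      ∀ x, x ∈ i.1 ↔ ∑ j, l j * x j = c :=
    fun i => exists_form_of_isHyperplane (hC.1 i.1 (Multiset.coe_mem))
  choose l c hne hmem using hform
  -- Indexing by `C` itself keeps multiplicities; coefficient `0` on the slack coordinate turns a
  -- nonzero linear part into a nonconstant form.
  refine ⟨C, Finset.univ, fun i => Fin.cons 0 (l i), c, ⟨fun i _ => ?_, fun a ha => ?_⟩, ?_⟩
  · obtain ⟨j, hj⟩ := hne i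
    exact ⟨j.succ, 0, by simpa using hj⟩
  · rw [Fin.sum_univ_succ] at ha
    have h1 := hC.2 (fun j => (a j.succ : ℝ)) ⟨fun j => a j.succ, fun _ => rfl, by
      change ∑ j : Fin d, a j.succ < n
      omega⟩
    rw [← C.map_univ_coe, Multiset.countP_map] at h1
    refine h1.trans (le_of_eq ?_)
    change (Finset.univ.filter fun i : C => (fun j => (a j.succ : ℝ)) ∈ i.1).card = _
    congr 1
    refine Finset.filter_congr fun i _ => ?_
    rw [hmem, Fin.sum_univ_succ]
    simp
  · rw [Finset.card_univ, Multiset.card_coe]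

/-! ### Values of the cover numbers -/

theorem kCoverNumber_mem {n d k : ℕ} (hd : 1 ≤ d) (hk : k ≤ d + 1) :
    ∃ C, IsKCover n d k C ∧ C.card = kCoverNumber n d k := by
  -- Some cover must exist, since `sInf ∅ = 0` would not be attained.
  obtain ⟨C, hC, -⟩ := exists_isKCover_of_layers (k := k) hd n (fun _ => n) (fun B hB => by
    rw [Finset.sum_const, smul_eq_mul]
    exact Nat.le_mul_of_pos_left _ (by omega))
  exact Nat.sInf_mem
    (s := {m | ∃ C : Multiset (AffineSubspace ℝ (Fin d → ℝ)), IsKCover n d k C ∧ C.card = m})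
    ⟨_, C, hC, rfl⟩

theorem kCoverNumber_le {n d k : ℕ} (hd : 1 ≤ d) (w : Fin (d + 1) → ℕ)
    (hw : ∀ B : Finset (Fin (d + 1)), d + 1 < B.card + k → n ≤ ∑ p ∈ B, w p) :
    kCoverNumber n d k ≤ ∑ p, w p :=
  Nat.sInf_le
    (s := {m | ∃ C : Multiset (AffineSubspace ℝ (Fin d → ℝ)), IsKCover n d k C ∧ C.card = m})
    (exists_isKCover_of_layers hd n w hw)

theorem coverNumber_eq {n d : ℕ} (hn : 1 ≤ n) (hd : 1 ≤ d) : coverNumber n d = n := by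
  classical
  have hup : ∃ C : Finset (AffineSubspace ℝ (Fin d → ℝ)), IsCover n d C ∧ C.card ≤ n := by
    choose L hL hmem using exists_isHyperplane_layer hd n 0
    refine ⟨(Finset.range n).image L, ⟨fun H hH => ?_, fun x hx => ?_⟩,
      Finset.card_image_le.trans (by simp)⟩
    · obtain ⟨l, -, rfl⟩ := Finset.mem_image.mp hH
      exact hL l
    · obtain ⟨b, hb, hlt⟩ := exists_nat_baryCoord hx
      refine ⟨L (b 0), Finset.mem_image_of_mem _ (Finset.mem_range.mpr ?_), (hmem _ _).mpr (hb 0)⟩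
      exact (Finset.single_le_sum (fun p _ => Nat.zero_le (b p)) (Finset.mem_univ 0)).trans_lt hlt
  obtain ⟨C, hC, hcard⟩ := hup
  have hle : coverNumber n d ≤ C.card := Nat.sInf_le
    (s := {m | ∃ C : Finset (AffineSubspace ℝ (Fin d → ℝ)), IsCover n d C ∧ C.card = m})
    ⟨C, hC, rfl⟩
  refine le_antisymm (hle.trans hcard) ?_
  obtain ⟨C', hC', hcard'⟩ := Nat.sInf_mem
    (s := {m | ∃ C : Finset (AffineSubspace ℝ (Fin d → ℝ)), IsCover n d C ∧ C.card = m})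
    ⟨_, C, hC, rfl⟩
  have hk : IsKCover n d 1 C'.val := ⟨hC'.1, fun x hx => by
    obtain ⟨H, hH, hxH⟩ := hC'.2 x hx
    exact Multiset.countP_pos.mpr ⟨H, hH, hxH⟩⟩
  obtain ⟨ι, s, lam, c, hF, hs⟩ := hk.exists_formCover hn
  obtain ⟨e, rfl⟩ := Nat.exists_eq_add_of_le' hd
  have := hF.le_card le_rfl
  change n ≤ sInf _
  rw [← hcard']
  change n ≤ C'.val.card
  omega

theorem kCoverNumber_two {n d : ℕ} (hn : 1 ≤ n) (hd : 1 ≤ d) :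
    kCoverNumber n d 2 = n + ⌈(n : ℝ) / (d : ℝ)⌉₊ := by
  have hd0 : (0 : ℝ) < d := by exact_mod_cast hd
  set q := ⌈(n : ℝ) / (d : ℝ)⌉₊ with hq
  apply le_antisymm
  · have hqd : n ≤ d * q := by
      have := Nat.le_ceil ((n : ℝ) / d)
      rw [div_le_iff₀ hd0, mul_comm] at this
      exact_mod_cast this
    -- The increments of `g` split `n` into `d` widths of at most `q`; with one more width `q` the
    -- total is `n + q`, and dropping any one facet leaves at least `n`.
    let g : ℕ → ℕ := fun j => min n (j * q)
    have hg : Monotone g := fun i j hij => min_le_min_left _ (Nat.mul_le_mul_right _ hij)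
    let w : Fin (d + 1) → ℕ := Fin.cons q fun j => g (j + 1) - g j
    have hsum : ∑ p, w p = n + q := by
      rw [Fin.sum_univ_succ]
      simp only [w, Fin.cons_zero, Fin.cons_succ]
      rw [Fin.sum_univ_eq_sum_range (fun j => g (j + 1) - g j), Finset.sum_range_tsub hg]
      simp only [g, zero_mul, Nat.min_zero, min_eq_left hqd]
      omega
    have hwq : ∀ p, w p ≤ q := fun p => by
      refine Fin.cases le_rfl (fun j => ?_) p
      simp only [w, Fin.cons_succ, g, Nat.add_mul, one_mul]
      omega
    refine (kCoverNumber_le hd w fun B hB => ?_).trans_eq hsum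
    have hcompl : Bᶜ.card ≤ 1 := by
      rw [Finset.card_compl, Fintype.card_fin]
      omega
    have h1 : ∑ p ∈ Bᶜ, w p ≤ q :=
      (Finset.sum_le_card_nsmul _ _ q fun p _ => hwq p).trans
        ((Nat.mul_le_mul_right q hcompl).trans (one_mul q).le)
    have h2 := Finset.sum_add_sum_compl B w
    omega
  · obtain ⟨C, hC, hcard⟩ := kCoverNumber_mem (n := n) hd (k := 2) (by omega)
    obtain ⟨ι, s, lam, c, hF, hs⟩ := hC.exists_formCover hn
    obtain ⟨e, rfl⟩ := Nat.exists_eq_add_of_le' hd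
    have h1 := hF.mul_le_mul_card_of_two
    rw [hs, hcard, Nat.sub_add_cancel hn] at h1
    generalize kCoverNumber n (e + 1) 2 = N at h1
    have hnN : n ≤ N := by nlinarith
    obtain ⟨r, rfl⟩ := Nat.exists_eq_add_of_le hnN
    refine Nat.add_le_add_left (Nat.ceil_le.mpr ?_) n
    rw [div_le_iff₀ hd0]
    have : n ≤ r * (e + 1) := by nlinarith
    exact_mod_cast this

theorem abs_kCoverNumber_three_sub_le {n d : ℕ} (hn : 1 ≤ n) (hd : 3 ≤ d) :
    |(kCoverNumber n d 3 : ℝ) - (1 + 2 / ((d : ℝ) - 1)) * (n : ℝ)| ≤ (d : ℝ) + 1 := by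
  obtain ⟨e, rfl⟩ := Nat.exists_eq_add_of_le' hd
  have he : (0 : ℝ) < (e : ℝ) + 2 := by positivity
  have hcoef : (1 + 2 / (((e + 3 : ℕ) : ℝ) - 1)) * (n : ℝ) =
      ((e : ℝ) + 4) * (n / ((e : ℝ) + 2)) := by
    have : ((e + 3 : ℕ) : ℝ) - 1 = (e : ℝ) + 2 := by push_cast; ring
    rw [this]
    field_simp
    ring
  rw [hcoef, abs_le]
  constructor
  · obtain ⟨C, hC, hcard⟩ := kCoverNumber_mem (n := n) (d := e + 3) (by omega) (k := 3) (by omega)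
    obtain ⟨ι, s, lam, c, hF, hs⟩ := hC.exists_formCover hn
    have h1 := hF.mul_le_mul_card_of_three
    rw [hs, hcard, Nat.sub_add_cancel hn] at h1
    have h2 : ((e : ℝ) + 4) * n ≤ ((e : ℝ) + 2) * kCoverNumber n (e + 3) 3 := by exact_mod_cast h1
    have h3 : ((e : ℝ) + 4) * (n / ((e : ℝ) + 2)) ≤ kCoverNumber n (e + 3) 3 := by
      rw [← mul_div_assoc, div_le_iff₀ he]
      linarith
    push_cast
    linarith
  -- Equal widths `q` at all `e + 4` facets; rounding up costs less than one per facet, hence the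
  -- constant `d + 1`.
  · set q := ⌈(n : ℝ) / ((e : ℝ) + 2)⌉₊ with hq
    have hqn : n ≤ (e + 2) * q := by
      have := Nat.le_ceil ((n : ℝ) / ((e : ℝ) + 2))
      rw [← hq, div_le_iff₀ he, mul_comm] at this
      exact_mod_cast this
    have hqlt : (q : ℝ) < n / ((e : ℝ) + 2) + 1 := Nat.ceil_lt_add_one (by positivity)
    have h1 : kCoverNumber n (e + 3) 3 ≤ (e + 4) * q := by
      refine (kCoverNumber_le (by omega) (fun _ => q) fun B hB => ?_).trans (by simp)
      rw [Finset.sum_const, smul_eq_mul]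
      exact hqn.trans (Nat.mul_le_mul_right q (by omega))
    have h2 : (kCoverNumber n (e + 3) 3 : ℝ) ≤ ((e : ℝ) + 4) * q := by exact_mod_cast h1
    have h3 : ((e : ℝ) + 4) * q ≤ ((e : ℝ) + 4) * (n / ((e : ℝ) + 2) + 1) :=
      mul_le_mul_of_nonneg_left hqlt.le (by positivity)
    push_cast
    linarith

theorem theorem3p1 :
    (∀ n d : ℕ, 1 ≤ n → 1 ≤ d → coverNumber n d = n) ∧
    (∀ n d : ℕ, 1 ≤ n → 1 ≤ d → kCoverNumber n d 2 = n + ⌈(n : ℝ) / (d : ℝ)⌉₊) ∧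
    (∀ d : ℕ, 3 ≤ d → ∃ K : ℝ, ∀ n : ℕ, 1 ≤ n →
      |(kCoverNumber n d 3 : ℝ) - (1 + 2 / ((d : ℝ) - 1)) * (n : ℝ)| ≤ K) :=
  ⟨fun _ _ hn hd => coverNumber_eq hn hd, fun _ _ hn hd => kCoverNumber_two hn hd,
    fun d hd => ⟨(d : ℝ) + 1, fun _ hn => abs_kCoverNumber_three_sub_le hn hd⟩⟩
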